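/- Definitions. Let $X$ be a metric space. A geodesic bicombing on $X$ is a map $\sigma\colon X\times X\times[0,1]\to X$ such that $\sigma_{xy}=\sigma(x,y,\cdot)$ satisfies $\sigma_{xy}(0)=x$, $\sigma_{xy}(1)=y$ and $d(\sigma_{xy}(t),\sigma_{xy}(t'))=|t-t'|\,d(x,y)$ for all $x,y\in X$ and $t,t'\in[0,1]$. It is convex if $t\mapsto d(\sigma_{xy}(t),\sigma_{x'y'}(t))$ is convex on $[0,1]$ for all $x,y,x',y'$; consistent if $\sigma_{pq}(\lambda)=\sigma_{xy}((1-\lambda)s+\lambda t)$ whenever $0\le s\le t\le 1$, $\lambda\in[0,1]$, $p=\sigma_{xy}(s)$, $q=\sigma_{xy}(t)$; reversible if $\sigma_{xy}(t)=\sigma_{yx}(1-t)$. A $\sigma$-geodesic line is a geodesic line $\gamma\colon\mathbb R\to X$ such that, for any two points $x,y$ of $\gamma$, $\sigma_{xy}$ parametrizes the subsegment of $\gamma$ between $x$ and $y$. The bicombing is geodesically complete if, for all $x\ne y$, the segment $\sigma_{xy}([0,1])$ is contained in a $\sigma$-geodesic line. A GCB-space is a pair $(X,\sigma)$ where $X$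 is a complete metric space and $\sigma$ is a geodesically complete, convex, consistent, reversible geodesic bicombing on $X$. The space $X$ is $\delta$-hyperbolic if $(x,z)_w\ge\min\{(x,y)_w,(y,z)_w\}-\delta$ for all $x,y,z,w\in X$, where $(y,z)_x=\frac12\big(d(x,y)+d(x,z)-d(y,z)\big)$. A $\sigma$-isometry is a (surjective) isometry $g$ of $X$ with $g(\sigma_{xy}(t))=\sigma_{g(x)g(y)}(t)$ for all $x,y\in X$, $t\in[0,1]$; an isometry $g$ is elliptic if its orbits $\{g^nx : n\in\mathbb Z\}$ are bounded. For $\varepsilon>0$ put $M_\varepsilon(g)=\{x\in X : d(x,gx)\le\varepsilon\}$. Proposition. For all $\varepsilon,\delta>0$ there exists a constant $c(\varepsilon,\delta)>0$, depending only on $\varepsilon$ and $\delta$, such that the following hold for every $\delta>0$, every proper $\delta$-hyperbolic GCB-space $(X,\sigma)$ and every non-elliptic $\sigma$-isometry $g$ of $X$. (1) For every $\varepsilon>0$ with $M_\varepsilon(g)\neq\emptyset$ and every $x\in X$, $$d(x,gx)\ \ge\ c(\varepsilon,\delta)\cdot d(x,M_\varepsilon(g)).$$ (2) For all $0<\varepsilon_1\le\varepsilon_2$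 with $M_{\varepsilon_1}(g)\ne\emptyset$, with the same function $c$, $$\sup_{x\in M_{\varepsilon_2}(g)} d(x,M_{\varepsilon_1}(g))\ \le\ \frac{\varepsilon_2}{c(\varepsilon_1,\delta)}.$$ -/

import Mathlib

universe u

/-- A geodesic bicombing on `X`: a choice, for every ordered pair of points `x`, `y`, of a geodesic
`σ x y : [0,1] → X` from `x` to `y`, parametrized proportionally to arc length. (The values of
`σ x y t` for `t ∉ [0,1]` are irrelevant and never used.) -/
structure IsGeodesicBicombing {X : Type*} [MetricSpace X] (σ : X → X → ℝ → X) : Prop where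
  dist_eq : ∀ x y : X, ∀ t ∈ Set.Icc (0 : ℝ) 1, ∀ t' ∈ Set.Icc (0 : ℝ) 1,
    dist (σ x y t) (σ x y t') = |t - t'| * dist x y
  source : ∀ x y : X, σ x y 0 = x
  target : ∀ x y : X, σ x y 1 = y

/-- A bicombing is convex if `t ↦ d(σ_{xy}(t), σ_{x'y'}(t))` is convex on `[0,1]`. -/
def IsConvexBicombing {X : Type*} [MetricSpace X] (σ : X → X → ℝ → X) : Prop :=
  ∀ x y x' y' : X, ConvexOn ℝ (Set.Icc (0 : ℝ) 1) (fun t => dist (σ x y t) (σ x' y' t))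

/-- A bicombing is consistent if the chosen geodesic between two points `σ_{xy}(s)`, `σ_{xy}(t)`
with `s ≤ t` is the corresponding subsegment of `σ_{xy}`. -/
def IsConsistentBicombing {X : Type*} (σ : X → X → ℝ → X) : Prop :=
  ∀ x y : X, ∀ s t : ℝ, 0 ≤ s → s ≤ t → t ≤ 1 → ∀ l ∈ Set.Icc (0 : ℝ) 1,
    σ (σ x y s) (σ x y t) l = σ x y ((1 - l) * s + l * t)

/-- A bicombing is reversible if `σ_{xy}(t) = σ_{yx}(1 - t)`. -/
def IsReversibleBicombing {X : Type*} (σ : X → X → ℝ → X) : Prop :=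
  ∀ x y : X, ∀ t ∈ Set.Icc (0 : ℝ) 1, σ x y t = σ y x (1 - t)

/-- A `σ`-geodesic line: a geodesic line `γ : ℝ → X` such that for any two points of `γ` the
`σ`-geodesic between them parametrizes the subsegment of `γ` that they bound. -/
def IsSigmaLine {X : Type*} [MetricSpace X] (σ : X → X → ℝ → X) (γ : ℝ → X) : Prop :=
  Isometry γ ∧ ∀ s t : ℝ, ∀ l ∈ Set.Icc (0 : ℝ) 1, σ (γ s) (γ t) l = γ ((1 - l) * s + l * t)

/-- A bicombing is geodesically complete if every (nondegenerate) `σ`-geodesic segment is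
contained in a `σ`-geodesic line. -/
def IsGeodesicallyComplete {X : Type*} [MetricSpace X] (σ : X → X → ℝ → X) : Prop :=
  ∀ x y : X, x ≠ y →
    ∃ γ : ℝ → X, IsSigmaLine σ γ ∧ σ x y '' Set.Icc (0 : ℝ) 1 ⊆ Set.range γ

/-- `(X, σ)` is a GCB-space: `X` is a complete metric space and `σ` is a geodesically complete,
convex, consistent, reversible geodesic bicombing on it. -/
structure IsGCBSpace (X : Type*) [MetricSpace X] (σ : X → X → ℝ → X) : Prop where
  complete : CompleteSpace X
  bicombing : IsGeodesicBicombing σ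
  convex : IsConvexBicombing σ
  consistent : IsConsistentBicombing σ
  reversible : IsReversibleBicombing σ
  geodesicallyComplete : IsGeodesicallyComplete σ

/-- The Gromov product `(y, z)_x`. -/
noncomputable def gromovProd {X : Type*} [MetricSpace X] (y z x : X) : ℝ :=
  (dist x y + dist x z - dist y z) / 2

/-- The four-point condition of `δ`-hyperbolicity:
`(x, z)_w ≥ min {(x, y)_w, (y, z)_w} - δ` for all `x, y, z, w`. -/
def IsDeltaHyperbolic (X : Type*) [MetricSpace X] (δ : ℝ) : Prop :=
  ∀ x y z w : X, min (gromovProd x y w) (gromovProd y z w) - δ ≤ gromovProd x z w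

/-- A `σ`-isometry: an isometry `g` with `σ_{g(x)g(y)} = g(σ_{xy})` for all `x`, `y`. -/
def IsSigmaIsometry {X : Type*} [MetricSpace X] (σ : X → X → ℝ → X) (g : X ≃ᵢ X) : Prop :=
  ∀ x y : X, ∀ t ∈ Set.Icc (0 : ℝ) 1, σ (g x) (g y) t = g (σ x y t)

/-- An isometry is elliptic if it has bounded orbits. -/
def IsEllipticIsometry {X : Type*} [MetricSpace X] (g : X ≃ᵢ X) : Prop :=
  ∀ x : X, Bornology.IsBounded (Set.range fun n : ℤ => (g ^ n) x)

/-- The Margulis domain `M_ε(g) = {x | d(x, gx) ≤ ε}`. -/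
def margulisDomain {X : Type*} [MetricSpace X] (g : X ≃ᵢ X) (ε : ℝ) : Set X :=
  {x | dist x (g x) ≤ ε}

/-! Displacement is convex along `σ`-geodesics, so linear growth away from `M_ε(g)` follows once it
exceeds `2 ε` at a definite distance `2 r`. Let `a` be a point of `M_ε(g)` nearest to `p`, at
distance `2 r`, and suppose `d(p, gp) ≤ 2 ε`. For `k ≤ 2 ^ m` the quadrilateral `a, p, g ^ k p, g ^
k a` is thin, so `g ^ k` moves the midpoint `q` of `[a, p]` by at most `6 δ`
(`dist_midpoint_midpoint_le`). Taking midpoints along the orbit of `q` repeatedly yields a point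
within `6 δ` of `q` with displacement at most `6 δ / 2 ^ m ≤ ε` (`exists_displacement_le`). This
point of `M_ε(g)` is closer to `p` than `2 r`, a contradiction. -/

/-- The four-point condition of hyperbolicity in terms of sums of opposite distances. -/
lemma IsDeltaHyperbolic.dist_add_dist_le {X : Type*} [MetricSpace X] {δ : ℝ}
    (h : IsDeltaHyperbolic X δ) (x y z w : X) :
    dist x y + dist z w ≤ max (dist x z + dist y w) (dist x w + dist y z) + 2 * δ := by
  have h1 := h x z y w
  simp only [gromovProd] at h1
  rw [dist_comm w x, dist_comm w y, dist_comm w z, dist_comm z y] at h1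
  rcases min_cases ((dist x w + dist z w - dist x z) / 2)
    ((dist z w + dist y w - dist y z) / 2) with ⟨h2, -⟩ | ⟨h2, -⟩
  · have := le_max_left (dist x z + dist y w) (dist x w + dist y z)
    linarith
  · have := le_max_right (dist x z + dist y w) (dist x w + dist y z)
    linarith

/-! ### Powers of an isometry and the Margulis domain -/

lemma IsometryEquiv.dist_pow_apply_le {X : Type*} [MetricSpace X] (g : X ≃ᵢ X) (x : X) (k : ℕ) :
    dist x ((g ^ k) x) ≤ k * dist x (g x) := by
  induction k with
  | zero => simp
  | succ k ih =>
    have h1 : dist ((g ^ k) x) ((g ^ (k + 1)) x) = dist x (g x) := by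
      rw [pow_succ]
      exact (g ^ k).dist_eq x (g x)
    have := dist_triangle x ((g ^ k) x) ((g ^ (k + 1)) x)
    push_cast
    linarith

lemma pow_apply_mem_margulisDomain {X : Type*} [MetricSpace X] {g : X ≃ᵢ X} {ε : ℝ} {x : X}
    (hx : x ∈ margulisDomain g ε) (k : ℕ) : (g ^ k) x ∈ margulisDomain g ε := by
  have h : g ((g ^ k) x) = (g ^ k) (g x) := by
    change (g * g ^ k) x = (g ^ k * g) x
    rw [← pow_succ, ← pow_succ']
  change dist _ _ ≤ ε
  rw [h, (g ^ k).dist_eq]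
  exact hx

lemma isClosed_margulisDomain {X : Type*} [MetricSpace X] (g : X ≃ᵢ X) (ε : ℝ) :
    IsClosed (margulisDomain g ε) :=
  isClosed_le (continuous_id.dist g.continuous) continuous_const

lemma infDist_pow_apply_margulisDomain {X : Type*} [MetricSpace X] (g : X ≃ᵢ X) (ε : ℝ) (x y : X)
    (hy : y ∈ margulisDomain g ε) (k : ℕ) :
    Metric.infDist x (margulisDomain g ε) ≤ dist x ((g ^ k) y) :=
  Metric.infDist_le_dist_of_mem (pow_apply_mem_margulisDomain hy k)

lemma IsSigmaIsometry.pow {X : Type*} [MetricSpace X] {σ : X → X → ℝ → X} {g : X ≃ᵢ X}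
    (hg : IsSigmaIsometry σ g) (k : ℕ) : IsSigmaIsometry σ (g ^ k) := by
  induction k with
  | zero => intro x y t _; rfl
  | succ k ih =>
    intro x y t ht
    rw [pow_succ]
    change σ ((g ^ k) (g x)) ((g ^ k) (g y)) t = (g ^ k) (g (σ x y t))
    rw [ih _ _ t ht, hg _ _ t ht]

lemma half_mem_Icc_zero_one : (1 / 2 : ℝ) ∈ Set.Icc (0 : ℝ) 1 := by
  constructor <;> norm_num

/-! ### Convexity and midpoints in GCB-spaces -/

namespace IsGCBSpace

variable {X : Type*} [MetricSpace X] {σ : X → X → ℝ → X}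

lemma dist_le (h : IsGCBSpace X σ) (x y x' y' : X) {t : ℝ} (ht : t ∈ Set.Icc (0 : ℝ) 1) :
    dist (σ x y t) (σ x' y' t) ≤ (1 - t) * dist x x' + t * dist y y' := by
  have h1 := (h.convex x y x' y').2 (x := 0) (y := 1) (by simp) (by simp)
    (sub_nonneg.2 ht.2) ht.1 (by ring)
  simpa [h.bicombing.source, h.bicombing.target] using h1

lemma dist_left (h : IsGCBSpace X σ) (x y : X) {t : ℝ} (ht : t ∈ Set.Icc (0 : ℝ) 1) :
    dist x (σ x y t) = t * dist x y := by
  have := h.bicombing.dist_eq x y 0 (by simp) t ht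
  rw [h.bicombing.source] at this
  simpa [abs_of_nonneg ht.1] using this

lemma dist_right (h : IsGCBSpace X σ) (x y : X) {t : ℝ} (ht : t ∈ Set.Icc (0 : ℝ) 1) :
    dist y (σ x y t) = (1 - t) * dist x y := by
  have := h.bicombing.dist_eq x y 1 (by simp) t ht
  rwa [h.bicombing.target, abs_of_nonneg (sub_nonneg.2 ht.2)] at this

lemma eq_self (h : IsGCBSpace X σ) (x : X) {t : ℝ} (ht : t ∈ Set.Icc (0 : ℝ) 1) :
    σ x x t = x := by
  have := h.dist_left x x ht
  rw [dist_self, mul_zero, dist_eq_zero] at this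
  exact this.symm

/-- The displacement of a `σ`-isometry is convex along `σ`-geodesics. -/
lemma dist_apply_le (h : IsGCBSpace X σ) {g : X ≃ᵢ X} (hg : IsSigmaIsometry σ g) (x y : X)
    {t : ℝ} (ht : t ∈ Set.Icc (0 : ℝ) 1) :
    dist (σ x y t) (g (σ x y t)) ≤ (1 - t) * dist x (g x) + t * dist y (g y) := by
  rw [← hg x y t ht]
  exact h.dist_le x y (g x) (g y) ht

/-- By reversibility both midpoints lie on geodesics issuing from `y`, so convexity applies. This
gives the halving in the averaging argument. -/
lemma dist_midpoint_le (h : IsGCBSpace X σ) (x y z : X) :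
    dist (σ x y (1 / 2)) (σ y z (1 / 2)) ≤ dist x z / 2 := by
  have h1 : σ x y (1 / 2) = σ y x (1 / 2) := by
    rw [h.reversible x y _ half_mem_Icc_zero_one]
    norm_num
  have := h.dist_le y x y z half_mem_Icc_zero_one
  rw [h1]
  rw [dist_self] at this
  linarith

/-- If the orbit segment of `q` of length `2 ^ m` stays in a ball, then the ball contains a point
with displacement at most `d(q, g ^ (2 ^ m) q) / 2 ^ m`. -/
lemma exists_displacement_le (h : IsGCBSpace X σ) {g : X ≃ᵢ X} (hg : IsSigmaIsometry σ g)
    (y : X) (C : ℝ) (m : ℕ) : ∀ (q : X) (D : ℝ),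
      (∀ k ≤ 2 ^ m, dist y ((g ^ k) q) ≤ C) → dist q ((g ^ 2 ^ m) q) ≤ D →
      ∃ b : X, dist y b ≤ C ∧ dist b (g b) ≤ D / 2 ^ m := by
  induction m with
  | zero =>
    intro q D h1 h2
    exact ⟨q, by simpa using h1 0 (by simp), by simpa using h2⟩
  | succ m ih =>
    intro q D h1 h2
    have hpow : ∀ k : ℕ, (g ^ k) (σ q ((g ^ 2 ^ m) q) (1 / 2)) =
        σ ((g ^ k) q) ((g ^ (k + 2 ^ m)) q) (1 / 2) := by
      intro k
      rw [← hg.pow k _ _ _ half_mem_Icc_zero_one, pow_add]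
      rfl
    -- Replace `q` by the midpoint of `q` and `g ^ 2 ^ m q`: its translates are midpoints of orbit
    -- points of `q`, so they stay in the ball, and `g ^ 2 ^ m` moves it by at most `D / 2`.
    obtain ⟨b, hb1, hb2⟩ := ih (σ q ((g ^ 2 ^ m) q) (1 / 2)) (D / 2) (by
      intro k hk
      rw [hpow, ← h.eq_self y half_mem_Icc_zero_one]
      have h3 := h.dist_le y y ((g ^ k) q) ((g ^ (k + 2 ^ m)) q) half_mem_Icc_zero_one
      have h4 := h1 k (by rw [pow_succ]; omega)
      have h5 := h1 (k + 2 ^ m) (by rw [pow_succ]; omega)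
      linarith) (by
      rw [hpow]
      have h3 := h.dist_midpoint_le q ((g ^ 2 ^ m) q) ((g ^ (2 ^ m + 2 ^ m)) q)
      rw [← mul_two, ← pow_succ] at h3 ⊢
      linarith)
    refine ⟨b, hb1, hb2.trans_eq ?_⟩
    rw [pow_succ]
    field_simp

/-- Suppose that a quadrilateral `a, p, p', a'` has two opposite sides `[a, p]`, `[a', p']` of
length `2 r`, while its other two sides are not longer than this and its diagonals are not shorter.
Then the midpoints of `[a, p]` and `[a', p']` are `6 δ`-close. -/
lemma dist_midpoint_midpoint_le (h : IsGCBSpace X σ) {δ r : ℝ} (hδ : 0 ≤ δ)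
    (hX : IsDeltaHyperbolic X δ) (a p a' p' : X) (hap : dist a p = 2 * r)
    (hap' : dist a' p' = 2 * r) (haa : dist a a' ≤ 2 * r) (hpp : dist p p' ≤ 2 * r)
    (h1 : 2 * r ≤ dist p a') (h2 : 2 * r ≤ dist p' a) :
    dist (σ a p (1 / 2)) (σ a' p' (1 / 2)) ≤ 6 * δ := by
  set q := σ a p (1 / 2)
  set q' := σ a' p' (1 / 2)
  have hq1 : dist a q = r := by rw [h.dist_left _ _ half_mem_Icc_zero_one, hap]; ring
  have hq2 : dist p q = r := by rw [h.dist_right _ _ half_mem_Icc_zero_one, hap]; ring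
  have hq1' : dist a' q' = r := by rw [h.dist_left _ _ half_mem_Icc_zero_one, hap']; ring
  have hq2' : dist p' q' = r := by rw [h.dist_right _ _ half_mem_Icc_zero_one, hap']; ring
  -- As each diagonal is at least `2 r`, this sum bound makes each at most `2 r + 2 δ`.
  have hdiag : dist p a' + dist p' a ≤ 4 * r + 2 * δ := by
    refine (hX.dist_add_dist_le p a' p' a).trans (add_le_add_left (max_le ?_ ?_) _)
    · rw [dist_comm a' a]; linarith
    · rw [dist_comm p a]; linarith
  have hqa : dist q a' ≤ r + 4 * δ := by
    have h3 : dist q a' + dist a p ≤ 3 * r + 2 * δ + 2 * δ := by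
      refine (hX.dist_add_dist_le q a' a p).trans (add_le_add_left (max_le ?_ ?_) _)
      · rw [dist_comm q a, dist_comm a' p]; linarith
      · rw [dist_comm q p, dist_comm a' a]; linarith
    linarith
  have hqp : dist q p' ≤ r + 4 * δ := by
    have h3 : dist q p' + dist a p ≤ 3 * r + 2 * δ + 2 * δ := by
      refine (hX.dist_add_dist_le q p' a p).trans (add_le_add_left (max_le ?_ ?_) _)
      · rw [dist_comm q a, dist_comm p' p]; linarith
      · rw [dist_comm q p]; linarith
    linarith
  have h3 : dist q q' + dist a' p' ≤ 2 * r + 4 * δ + 2 * δ := by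
    refine (hX.dist_add_dist_le q q' a' p').trans (add_le_add_left (max_le ?_ ?_) _)
    · rw [dist_comm q' p']; linarith
    · rw [dist_comm q' a']; linarith
  linarith

/-! ### Growth of the displacement -/

/-- A point whose distance from the Margulis domain `M_ε(g)` is a large enough number, depending
only on `ε` and `δ`, is displaced by more than `2 ε`. -/
lemma two_mul_lt_displacement (h : IsGCBSpace X σ) {ε δ r : ℝ} {m : ℕ} (hδ : 0 ≤ δ)
    (hX : IsDeltaHyperbolic X δ) {g : X ≃ᵢ X} (hg : IsSigmaIsometry σ g)
    (hm : 6 * δ ≤ ε * 2 ^ m) (hr : ε * 2 ^ m ≤ r) (hr' : 6 * δ < r) {a p : X}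
    (ha : a ∈ margulisDomain g ε) (hap : dist a p = 2 * r)
    (hp : Metric.infDist p (margulisDomain g ε) = 2 * r) : 2 * ε < dist p (g p) := by
  by_contra! hfp
  have ha' : dist a (g a) ≤ ε := ha
  have hε : 0 ≤ ε := dist_nonneg.trans ha'
  have hq : ∀ k ≤ 2 ^ m, dist (σ a p (1 / 2)) ((g ^ k) (σ a p (1 / 2))) ≤ 6 * δ := by
    intro k hk
    have hk' : (k : ℝ) ≤ 2 ^ m := by exact_mod_cast hk
    have hkε : k * ε ≤ r := by nlinarith
    have hk0 : (0 : ℝ) ≤ k := k.cast_nonneg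
    rw [← hg.pow k _ _ _ half_mem_Icc_zero_one]
    refine h.dist_midpoint_midpoint_le hδ hX _ _ _ _ hap (by rw [(g ^ k).dist_eq, hap]) ?_ ?_ ?_ ?_
    · have := g.dist_pow_apply_le a k
      nlinarith
    · have := g.dist_pow_apply_le p k
      nlinarith
    · rw [← hp]
      exact infDist_pow_apply_margulisDomain g ε p a ha k
    · rw [← hp]
      -- The second diagonal is `d(p, g ^ (-k) a)`, and `g ^ (-k) a` also lies in `M_ε(g)`.
      refine le_trans ?_ (?_ : dist p ((g ^ k).symm a) ≤ _)
      · refine Metric.infDist_le_dist_of_mem ?_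
        have hcomm : g ((g ^ k).symm a) = (g ^ k).symm (g a) := by
          apply (g ^ k).injective
          rw [(g ^ k).apply_symm_apply]
          change (g ^ k * g) _ = _
          rw [← pow_succ, pow_succ']
          exact congrArg g ((g ^ k).apply_symm_apply a)
        change dist _ _ ≤ ε
        rw [hcomm, (g ^ k).symm.dist_eq]
        exact ha
      · rw [← (g ^ k).dist_eq, (g ^ k).apply_symm_apply]
  obtain ⟨b, hb1, hb2⟩ := h.exists_displacement_le hg _ _ m _ _ hq (hq _ le_rfl)
  have hb : b ∈ margulisDomain g ε := hb2.trans (by rwa [div_le_iff₀ (by positivity)])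
  have h1 := Metric.infDist_le_dist_of_mem (x := p) hb
  have h2 := dist_triangle p (σ a p (1 / 2)) b
  have h3 := h.dist_right a p half_mem_Icc_zero_one
  -- `d(p, b) ≤ r + 6 δ < 2 r`, although `b` lies in `M_ε(g)`.
  linarith

/-- The displacement function grows at least linearly with the distance from the Margulis domain,
at a rate depending only on `ε` and `δ`. -/
lemma mul_infDist_margulisDomain_le [ProperSpace X] (h : IsGCBSpace X σ) {ε δ r : ℝ} {m : ℕ}
    (hδ : 0 < δ) (hX : IsDeltaHyperbolic X δ) {g : X ≃ᵢ X}
    (hg : IsSigmaIsometry σ g) (hm : 6 * δ ≤ ε * 2 ^ m) (hr : ε * 2 ^ m ≤ r) (hr' : 6 * δ < r)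
    (hne : (margulisDomain g ε).Nonempty) (x : X) :
    ε / (2 * r) * Metric.infDist x (margulisDomain g ε) ≤ dist x (g x) := by
  have hr0 : 0 < r := by linarith
  obtain ⟨a, ha, hxa⟩ := (isClosed_margulisDomain g ε).exists_infDist_eq_dist hne x
  set D := Metric.infDist x (margulisDomain g ε) with hD
  have ha' : dist a (g a) ≤ ε := ha
  have hε : 0 ≤ ε := dist_nonneg.trans ha'
  by_cases hx : x ∈ margulisDomain g ε
  · rw [hD, Metric.infDist_zero_of_mem hx, mul_zero]
    exact dist_nonneg
  have hx' : ε < dist x (g x) := not_le.1 hx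
  rw [div_mul_eq_mul_div, div_le_iff₀ (by positivity)]
  rcases le_total D (2 * r) with hDr | hDr
  -- Near the domain, displacement greater than `ε` already suffices.
  · have : 0 ≤ D := Metric.infDist_nonneg
    nlinarith
  · have hD0 : 0 < D := by linarith
    have ht : 2 * r / D ∈ Set.Icc (0 : ℝ) 1 := ⟨by positivity, (div_le_one hD0).2 hDr⟩
    have hax : dist a x = D := by rw [dist_comm, hxa]
    have htD : 2 * r / D * D = 2 * r := div_mul_cancel₀ _ hD0.ne'
    have hap : dist a (σ a x (2 * r / D)) = 2 * r := by rw [h.dist_left _ _ ht, hax, htD]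
    have hpx : dist x (σ a x (2 * r / D)) = D - 2 * r := by
      rw [h.dist_right _ _ ht, hax, sub_mul, htD, one_mul]
    have hp : Metric.infDist (σ a x (2 * r / D)) (margulisDomain g ε) = 2 * r := by
      apply le_antisymm
      · exact (Metric.infDist_le_dist_of_mem ha).trans_eq ((dist_comm _ _).trans hap)
      · have := Metric.infDist_le_infDist_add_dist (s := margulisDomain g ε) (x := x)
          (y := σ a x (2 * r / D))
        linarith
    have h1 := h.two_mul_lt_displacement hδ.le hX hg hm hr hr' ha hap hp
    have h2 := h.dist_apply_le hg a x ht
    -- With `t = 2 r / D`, convexity gives `2 ε < (1 - t) ε + t d(x, gx)`.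
    have h3 : ε ≤ 2 * r / D * dist x (g x) := by nlinarith [ht.1, ht.2]
    rw [div_mul_eq_mul_div, le_div_iff₀ hD0] at h3
    linarith

end IsGCBSpace

theorem mainTheorem11 :
    ∃ c : ℝ → ℝ → ℝ,
      (∀ ε δ : ℝ, 0 < ε → 0 < δ → 0 < c ε δ) ∧
      (∀ ε δ : ℝ, 0 < ε → 0 < δ →
        ∀ (X : Type u) [MetricSpace X] [ProperSpace X] (σ : X → X → ℝ → X),
          IsGCBSpace X σ → IsDeltaHyperbolic X δ →
          ∀ g : X ≃ᵢ X, IsSigmaIsometry σ g → ¬ IsEllipticIsometry g →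
            (margulisDomain g ε).Nonempty →
            ∀ x : X, c ε δ * Metric.infDist x (margulisDomain g ε) ≤ dist x (g x)) ∧
      (∀ ε₁ ε₂ δ : ℝ, 0 < ε₁ → ε₁ ≤ ε₂ → 0 < δ →
        ∀ (X : Type u) [MetricSpace X] [ProperSpace X] (σ : X → X → ℝ → X),
          IsGCBSpace X σ → IsDeltaHyperbolic X δ →
          ∀ g : X ≃ᵢ X, IsSigmaIsometry σ g → ¬ IsEllipticIsometry g →
            (margulisDomain g ε₁).Nonempty →
            (⨆ x ∈ margulisDomain g ε₂, Metric.infEDist x (margulisDomain g ε₁)) ≤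
              ENNReal.ofReal (ε₂ / c ε₁ δ)) := by
  -- This is `ε / (2 r)` with `m = ⌈6 δ / ε⌉`, so that `6 δ ≤ ε 2 ^ m`, and `r = ε 2 ^ m + 7 δ`, so
  -- that `r > 6 δ`.
  set c : ℝ → ℝ → ℝ := fun ε δ => ε / (2 * (ε * 2 ^ ⌈6 * δ / ε⌉₊ + 7 * δ)) with hc
  have hpos : ∀ ε δ : ℝ, 0 < ε → 0 < δ → 0 < c ε δ := by
    intro ε δ hε hδ
    rw [hc]
    positivity
  have hmain : ∀ ε δ : ℝ, 0 < ε → 0 < δ →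
        ∀ (X : Type u) [MetricSpace X] [ProperSpace X] (σ : X → X → ℝ → X),
          IsGCBSpace X σ → IsDeltaHyperbolic X δ →
          ∀ g : X ≃ᵢ X, IsSigmaIsometry σ g → ¬ IsEllipticIsometry g →
            (margulisDomain g ε).Nonempty →
            ∀ x : X, c ε δ * Metric.infDist x (margulisDomain g ε) ≤ dist x (g x) := by
    intro ε δ hε hδ X _ _ σ h hX g hg _ hne x
    have hm : 6 * δ ≤ ε * 2 ^ ⌈6 * δ / ε⌉₊ := by
      have h1 : 6 * δ / ε ≤ ⌈6 * δ / ε⌉₊ := Nat.le_ceil _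
      have h2 : (⌈6 * δ / ε⌉₊ : ℝ) ≤ 2 ^ ⌈6 * δ / ε⌉₊ := by
        exact_mod_cast Nat.lt_two_pow_self.le
      rw [mul_comm ε]
      exact (div_le_iff₀ hε).1 (h1.trans h2)
    exact h.mul_infDist_margulisDomain_le hδ hX hg hm (by linarith) (by linarith) hne x
  refine ⟨c, hpos, hmain, ?_⟩
  intro ε₁ ε₂ δ hε₁ _ hδ X _ _ σ h hX g hg hell hne
  refine iSup₂_le fun x hx => ?_
  have h1 := hmain ε₁ δ hε₁ hδ X σ h hX g hg hell hne x
  have h2 : dist x (g x) ≤ ε₂ := hx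
  rw [← ENNReal.ofReal_toReal (Metric.infEDist_ne_top hne)]
  refine ENNReal.ofReal_le_ofReal ?_
  rw [le_div_iff₀ (hpos ε₁ δ hε₁ hδ), mul_comm]
  exact h1.trans h2
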